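/- **Theorem.** Let $\mathbb N_0^\times$ be the multiplicative monoid of non-negative integers, regarded as a category with one object $*$, and let $\widehat{\mathbb N_0^\times}$ be the topos of presheaves of sets on it. For a subgroup $H\subset\mathbb Q$ let $H^+=\{q\in H: q\ge 0\}$, regarded as a functor $\mathbb N_0^\times\to\mathrm{Sets}$ through multiplication by non-negative integers. For a prime $p$ let $H(p)=\mathbb Z[1/p]\subset\mathbb Q$ be the group of fractions whose denominator is a power of $p$, and let $H(\eta)=\{0\}$ for the generic point $\eta$ of $\operatorname{Spec}\mathbb Z$. Let $\mathcal S$ be the sheaf of sets on $\operatorname{Spec}\mathbb Z$ (Zariski topology) whose sections over an open set $U$ are the families $(\xi_x)_{x\in U}$ with $\xi_x\in H(x)^+$ and $\xi_x\ne0$ for only finitely many $x\in U$, with the obvious restriction maps; $\mathbb N_0^\times$ acts on $\mathcal S$ by $(n\xi)_x=n\xi_x$. For every point $x$, evaluation at $x$ identifies the stalk $\mathcal S_x$, with its action of $\mathbb N_0^\times$, with $H(x)^+$. The functor $F:\mathbb N_0^\times\to\mathrm{Sh}(\operatorname{Spec}\mathbb Z)$ which sends $*$ to $\mathcal S$ and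 the endomorphisms of $*$ to the action of $\mathbb N_0^\times$ on $\mathcal S$ is filtering, that is: 1. the map $F(*)\to 1$ is an epimorphism; 2. the family of all maps $(F(u),F(v)):F(*)\to F(*)\times F(*)$, $u,v\in\mathbb N_0^\times$, is epimorphic; 3. for all $u,v\in\mathbb N_0^\times$, the family of maps from $F(*)$ to the equalizer of $F(u),F(v)$ induced by the $F(w)$ with $uw=vw$ is epimorphic. Moreover $F$ is flat, i.e. the functor $-\otimes_{\mathbb N_0^\times}F:\widehat{\mathbb N_0^\times}\to\mathrm{Sh}(\operatorname{Spec}\mathbb Z)$ (the left Kan extension of $F$ along the Yoneda embedding) preserves finite limits. Hence $F$ defines a geometric morphism $\Theta:\mathrm{Sh}(\operatorname{Spec}\mathbb Z)\to\widehat{\mathbb N_0^\times}$ with inverse image $\Theta^*=-\otimes_{\mathbb N_0^\times}F$ and direct image $\Theta_*=\mathrm{Hom}(F(-),-)$. A geometric morphism $f:\mathrm{Sh}(\operatorname{Spec}\mathbb Z)\to\widehat{\mathbb N_0^\times}$ is isomorphic to $\Theta$ if and only if the restriction of $f^*$ along the Yoneda embedding is isomorphic to $F$. For every prime $p$, the functor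 $H(p)^+:\mathbb N_0^\times\to\mathrm{Sets}$ is flat, and the image under $\Theta$ of the point $p$ of $\operatorname{Spec}\mathbb Z$ (the composite of $\Theta$ with the point of $\mathrm{Sh}(\operatorname{Spec}\mathbb Z)$ given by the stalk functor at $p$) is isomorphic to the point of $\widehat{\mathbb N_0^\times}$ defined by $H(p)^+$. Likewise $\{0\}^+$ is flat, and the image under $\Theta$ of the generic point is isomorphic to the base point of $\widehat{\mathbb N_0^\times}$, i.e. the point defined by the subgroup $\{0\}\subset\mathbb Q$. -/

import Mathlib

open CategoryTheory CategoryTheory.Limits TopologicalSpace Opposite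

universe v u₁ u₂ u₃

/-! ### Geometric morphisms, filtering functors, flat functors -/

/-- A geometric morphism `ℰ ⟶ ℱ`: a direct image functor `ℰ ⥤ ℱ` together with a left adjoint
(the inverse image functor) which preserves finite limits. -/
structure GeomMorphism (ℰ : Type u₁) [Category.{v} ℰ] (ℱ : Type u₂) [Category.{v} ℱ] where
  inverseImage : ℱ ⥤ ℰ
  directImage : ℰ ⥤ ℱ
  adj : inverseImage ⊣ directImage
  leftExact : PreservesFiniteLimits inverseImage

namespace GeomMorphism

variable {ℰ : Type u₁} [Category.{v} ℰ] {ℱ : Type u₂} [Category.{v} ℱ]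
  {𝒢 : Type u₃} [Category.{v} 𝒢]

/-- The composite `ℰ ⟶ ℱ ⟶ 𝒢` of two geometric morphisms. -/
def comp (f : GeomMorphism ℰ ℱ) (g : GeomMorphism ℱ 𝒢) : GeomMorphism ℰ 𝒢 where
  inverseImage := g.inverseImage ⋙ f.inverseImage
  directImage := f.directImage ⋙ g.directImage
  adj := g.adj.comp f.adj
  leftExact :=
    have := f.leftExact
    have := g.leftExact
    comp_preservesFiniteLimits _ _

/-- Two geometric morphisms are isomorphic when their inverse image functors are
(equivalently, by adjunction, when their direct image functors are). -/
def Isomorphic (f g : GeomMorphism ℰ ℱ) : Prop :=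
  Nonempty (f.inverseImage ≅ g.inverseImage)

end GeomMorphism

/-- A family of morphisms `f i : A i ⟶ B` is epimorphic if two morphisms out of `B` which agree
after composition with every `f i` are equal. -/
def IsEpimorphicFamily {ℰ : Type u₁} [Category.{v} ℰ] {ι : Sort*} {A : ι → ℰ} {B : ℰ}
    (f : ∀ i, A i ⟶ B) : Prop :=
  ∀ ⦃Z : ℰ⦄ (g h : B ⟶ Z), (∀ i, f i ≫ g = f i ≫ h) → g = h

/-- A functor `A : C ⥤ ℰ` from a small category to a topos is filtering if
* the family of all maps `A c ⟶ 1` is epimorphic;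
* for all `c`, `d`, the family of all maps `(A u, A v) : A b ⟶ A c × A d`, for
  `u : b ⟶ c` and `v : b ⟶ d` in `C`, is epimorphic;
* for all `u v : c ⟶ d`, the family of all maps `A b ⟶ Eq(A u, A v)` induced by the
  `w : b ⟶ c` with `u ∘ w = v ∘ w` is epimorphic. -/
structure IsFiltering {C : Type u₁} [Category.{v} C] {ℰ : Type u₂} [Category.{v} ℰ]
    [HasFiniteLimits ℰ] (A : C ⥤ ℰ) : Prop where
  nonempty : IsEpimorphicFamily fun c : C ↦ terminal.from (A.obj c)
  pair (c d : C) : IsEpimorphicFamily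
    fun i : (b : C) × (b ⟶ c) × (b ⟶ d) ↦ prod.lift (A.map i.2.1) (A.map i.2.2)
  parallel {c d : C} (s t : c ⟶ d) : IsEpimorphicFamily
    fun i : (b : C) × {w : b ⟶ c // w ≫ s = w ≫ t} ↦
      equalizer.lift (f := A.map s) (g := A.map t) (A.map i.2.1)
        (by rw [← A.map_comp, ← A.map_comp, i.2.2])

section Flat

variable {C : Type v} [SmallCategory C] {ℰ : Type u₂} [Category.{v} ℰ] [HasColimits ℰ]

/-- The tensor product functor `P ↦ P ⊗_C A` from presheaves on `C` to `ℰ`, i.e. the left Kan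
extension of `A` along the Yoneda embedding; it is left adjoint to
`E ↦ (c ↦ Hom (A c, E))`. (`uliftYoneda.{v}` is the Yoneda embedding of `C`, up to a `ULift`
which does not change the universe.) -/
noncomputable abbrev tensorFunctor (A : C ⥤ ℰ) : (Cᵒᵖ ⥤ Type v) ⥤ ℰ :=
  uliftYoneda.{v}.leftKanExtension A

/-- A functor from a small category to a topos is flat if tensoring with it preserves finite
limits. -/
def IsFlat (A : C ⥤ ℰ) : Prop :=
  PreservesFiniteLimits (tensorFunctor A)

/-- The geometric morphism from `ℰ` to the presheaf topos of `C` defined by a flat functor `A`: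
its inverse image is `P ↦ P ⊗_C A` and its direct image is `E ↦ (c ↦ Hom (A c, E))`. -/
noncomputable def GeomMorphism.ofFlat (A : C ⥤ ℰ) (hA : IsFlat A) :
    GeomMorphism ℰ (Cᵒᵖ ⥤ Type v) where
  inverseImage := tensorFunctor A
  directImage := Presheaf.restrictedULiftYoneda.{v} A
  adj := Presheaf.uliftYonedaAdjunction.{v} _ (uliftYoneda.{v}.leftKanExtensionUnit A)
  leftExact := hA

end Flat

/-! ### The topos of sheaves of sets on a topological space, and its points -/

instance sheaf_hasFiniteLimits (X : TopCat.{0}) : HasFiniteLimits (TopCat.Sheaf Type X) :=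
  inferInstanceAs (HasFiniteLimits (CategoryTheory.Sheaf (Opens.grothendieckTopology X) Type))

instance sheaf_hasColimits (X : TopCat.{0}) : HasColimits (TopCat.Sheaf Type X) :=
  inferInstanceAs (HasColimits (CategoryTheory.Sheaf (Opens.grothendieckTopology X) Type))

/-- The functor sending a sheaf of sets on `X` to its stalk at `x`. -/
noncomputable abbrev stalkAt {X : TopCat.{0}} (x : X) : TopCat.Sheaf Type X ⥤ Type :=
  TopCat.Sheaf.forget Type X ⋙ TopCat.Presheaf.stalkFunctor Type x

theorem stalkAt_preservesFiniteLimits {X : TopCat.{0}} (x : X) :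
    PreservesFiniteLimits (stalkAt x) :=
  comp_preservesFiniteLimits
    (CategoryTheory.sheafToPresheaf (Opens.grothendieckTopology X) Type)
    ((Functor.whiskeringLeft (OpenNhds x)ᵒᵖ (Opens X)ᵒᵖ Type).obj
      (OpenNhds.inclusion x).op ⋙ colim)

open Classical in
/-- The point of the topos of sheaves on `X` given by `x : X`: the inverse image is the
stalk functor at `x` and the direct image is the skyscraper sheaf functor. -/
noncomputable def pointOfSpace {X : TopCat.{0}} (x : X) :
    GeomMorphism Type (TopCat.Sheaf Type X) where
  inverseImage := stalkAt x
  directImage := skyscraperSheafFunctor x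
  adj := stalkSkyscraperSheafAdjunction x
  leftExact := stalkAt_preservesFiniteLimits x

/-! ### The monoid `ℕ₀ˣ` and the sets with action attached to subgroups of `ℚ` -/

/-- The category with one object whose monoid of endomorphisms is the multiplicative monoid of
non-negative integers. -/
abbrev NZeroTimes : Type := SingleObj ℕ

/-- The unique object of `NZeroTimes`. -/
abbrev NZeroTimes.pt : NZeroTimes := SingleObj.star ℕ

/-- The non-negative part of a subgroup `H` of `ℚ`. -/
def nonnegPart (H : AddSubgroup ℚ) : AddSubmonoid ℚ where
  carrier := {q | q ∈ H ∧ 0 ≤ q}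
  add_mem' ha hb := ⟨H.add_mem ha.1 hb.1, add_nonneg ha.2 hb.2⟩
  zero_mem' := ⟨H.zero_mem, le_rfl⟩

/-- The functor from `NZeroTimes` to sets given by the non-negative part of a subgroup `H` of `ℚ`,
on which the non-negative integers act by multiplication. -/
def nonnegFunctor (H : AddSubgroup ℚ) : NZeroTimes ⥤ Type where
  obj _ := nonnegPart H
  map n := ↾fun q ↦ (show ℕ from n) • q
  map_id _ := by
    ext q
    exact congrArg Subtype.val (one_nsmul q)
  map_comp m n := by
    ext q
    exact congrArg Subtype.val (mul_nsmul' q n m)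

/-- The group `H(p) = ℤ[1/p]` of fractions whose denominator is a power of `p`. -/
def fractionGroup (p : ℕ) : AddSubgroup ℚ where
  carrier := {q | ∃ (k : ℕ) (a : ℤ), q * (p : ℚ) ^ k = a}
  add_mem' := by
    rintro q r ⟨k, a, hq⟩ ⟨l, b, hr⟩
    refine ⟨k + l, a * p ^ l + b * p ^ k, ?_⟩
    push_cast
    rw [← hq, ← hr]
    ring
  zero_mem' := ⟨0, 0, by simp⟩
  neg_mem' := by
    rintro q ⟨k, a, hq⟩
    exact ⟨k, -a, by push_cast; rw [← hq]; ring⟩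

/-! ### The spectrum of `ℤ` and the sheaf `𝒮` -/

/-- `Spec ℤ` with its Zariski topology. -/
abbrev SpecZ : TopCat.{0} := TopCat.of (PrimeSpectrum ℤ)

/-- The point of `Spec ℤ` given by a rational prime. -/
def primePoint (p : Nat.Primes) : SpecZ :=
  (⟨Ideal.span {((p : ℕ) : ℤ)},
    (Ideal.span_singleton_prime (by exact_mod_cast p.2.ne_zero)).2
      (Nat.prime_iff_prime_int.1 p.2)⟩ : PrimeSpectrum ℤ)

/-- The generic point of `Spec ℤ`. -/
def genericPointZ : SpecZ := (⊥ : PrimeSpectrum ℤ)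

open Classical in
/-- The subgroup of `ℚ` attached to a point of `Spec ℤ`: it is `{0}` at the generic point, and
`H(p)` at the point given by a prime `p` (which is the absolute norm of the ideal `(p)`);
see `pointGroup_generic` and `pointGroup_prime`. -/
noncomputable def pointGroup (x : SpecZ) : AddSubgroup ℚ :=
  if x = genericPointZ then ⊥ else fractionGroup (Ideal.absNorm (PrimeSpectrum.asIdeal x))

theorem pointGroup_generic : pointGroup genericPointZ = ⊥ := if_pos rfl

theorem primePoint_ne_generic (p : Nat.Primes) : primePoint p ≠ genericPointZ := by
  intro h
  have h' : Ideal.span {((p : ℕ) : ℤ)} = ⊥ := congrArg PrimeSpectrum.asIdeal h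
  rw [Ideal.span_singleton_eq_bot] at h'
  exact p.2.ne_zero (by exact_mod_cast h')

theorem pointGroup_prime (p : Nat.Primes) : pointGroup (primePoint p) = fractionGroup p := by
  rw [pointGroup, if_neg (primePoint_ne_generic p)]
  have : Ideal.absNorm (Ideal.span {((p : ℕ) : ℤ)}) = p := by
    rw [Ideal.absNorm_span_singleton]; simp
  exact congrArg fractionGroup this

theorem genericPointZ_mem {U : Opens SpecZ} {x : SpecZ} (hx : x ∈ U) : genericPointZ ∈ U :=
  (PrimeSpectrum.le_iff_specializes (⊥ : PrimeSpectrum ℤ) x |>.1 bot_le).mem_open U.2 hx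

theorem finite_compl_of_mem {U : Opens SpecZ} (hU : genericPointZ ∈ U) :
    {x : SpecZ | x ∉ U}.Finite := by
  obtain ⟨s, hs⟩ := (PrimeSpectrum.isOpen_iff (U : Set (PrimeSpectrum ℤ))).1 U.2
  obtain ⟨n, hn, hn0⟩ : ∃ n ∈ s, n ≠ (0 : ℤ) := by
    by_contra! hcon
    have : genericPointZ ∈ (U : Set SpecZ)ᶜ := by
      rw [hs]
      exact fun n hn ↦ hcon n hn
    exact this hU
  have hfin : {I : Ideal ℤ | Ideal.span {n} ≤ I}.Finite := by
    have hne : Ideal.span {n} ≠ ⊥ := by rwa [Ne, Ideal.span_singleton_eq_bot]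
    have hft := UniqueFactorizationMonoid.fintypeSubtypeDvd (Ideal.span {n}) hne
    have hset : {I : Ideal ℤ | Ideal.span {n} ≤ I} = {I | I ∣ Ideal.span {n}} := by
      ext I
      exact Ideal.dvd_iff_le.symm
    rw [hset]
    exact Set.finite_coe_iff.1 (@Finite.of_fintype _ hft)
  refine Set.Finite.of_injOn (f := fun x : SpecZ ↦ PrimeSpectrum.asIdeal x) ?_ ?_ hfin
  · intro x hx
    have hx' : x ∈ (U : Set SpecZ)ᶜ := hx
    rw [hs] at hx'
    exact (Ideal.span_singleton_le_iff_mem _).2 (hx' hn)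
  · intro x _ y _ hxy
    exact PrimeSpectrum.ext hxy

/-- The condition, on a family `ξ` of elements `ξ x` of the non-negative parts of the groups
attached to the points `x` of an open subset `U` of `Spec ℤ`, that `ξ x ≠ 0` for only finitely
many `x` in `U`. This condition is local. -/
def finitelySupported : TopCat.LocalPredicate (X := SpecZ) fun x ↦ nonnegPart (pointGroup x) where
  pred {U} ξ := {x : U | ξ x ≠ 0}.Finite
  res {U V} i ξ h := by
    refine Set.Finite.of_injOn (f := fun x : U ↦ (⟨x, i.le x.2⟩ : V)) (fun x hx ↦ hx) ?_ h
    intro x _ y _ hxy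
    exact Subtype.ext (congrArg (fun z : V ↦ (z : SpecZ)) hxy)
  locality {U} ξ h := by
    by_cases hU : genericPointZ ∈ U
    · obtain ⟨V, hV, i, hfin⟩ := h ⟨genericPointZ, hU⟩
      refine ((hfin.image fun x : V ↦ (⟨x, i.le x.2⟩ : U)).union
        ((finite_compl_of_mem hV).preimage Subtype.val_injective.injOn)).subset ?_
      intro x hx
      by_cases hxV : (x : SpecZ) ∈ V
      · exact Or.inl ⟨⟨x, hxV⟩, hx, rfl⟩
      · exact Or.inr hxV
    · have : IsEmpty U := ⟨fun x ↦ hU (genericPointZ_mem x.2)⟩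
      exact Set.toFinite _

/-- The sheaf `𝒮` on `Spec ℤ`: its sections over `U` are the families `ξ` of elements
`ξ x ∈ H(x)⁺`, for `x ∈ U`, such that `ξ x ≠ 0` for only finitely many `x`, where `H(x)` is
`ℤ[1/p]` at a prime `p` and `{0}` at the generic point. -/
noncomputable def sheafS : TopCat.Sheaf Type SpecZ :=
  TopCat.subsheafToTypes finitelySupported

/-- The endomorphism of `𝒮` given by pointwise multiplication by `n`: `(n ξ) x = n (ξ x)`. -/
noncomputable def mulS (n : ℕ) : sheafS ⟶ sheafS :=
  ⟨{ app := fun U ↦ ↾fun ξ : {ξ : ∀ x : U.unop, nonnegPart (pointGroup x) //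
        finitelySupported.pred ξ} ↦
          ⟨fun x ↦ n • ξ.1 x, ξ.2.subset fun x hx h0 ↦ hx (by
            change ξ.1 x = 0 at h0
            change n • ξ.1 x = 0
            rw [h0, smul_zero])⟩
     naturality := fun U V i ↦ rfl }⟩

/-- The functor from `NZeroTimes` to sheaves of sets on `Spec ℤ` given by `𝒮` together with the
action of the non-negative integers by multiplication. -/
noncomputable def functorS : NZeroTimes ⥤ TopCat.Sheaf Type SpecZ where
  obj _ := sheafS
  map n := mulS n
  map_id _ := by
    apply CategoryTheory.Sheaf.hom_ext
    ext U ξ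
    refine Subtype.ext (funext fun x ↦ ?_)
    exact one_nsmul (ξ.1 x)
  map_comp m n := by
    apply CategoryTheory.Sheaf.hom_ext
    ext U ξ
    refine Subtype.ext (funext fun x ↦ ?_)
    exact mul_nsmul' (ξ.1 x) n m

/-!
Everything is tested on the points of `Spec ℤ`. The stalk functors preserve finite limits and
colimits and jointly reflect isomorphisms, so a functor to sheaves is filtering, respectively flat,
as soon as its stalks are. The stalk of `𝒮` at `x` is `H(x)⁺`: a finitely supported family vanishes
on a punctured neighbourhood of `x`, because its component at the generic point is zero and finite
sets of closed points are closed. A set-valued functor is filtering and flat when its category of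
elements is cofiltered, and this holds for `H⁺` with `H ≤ ℚ`: two elements of `H⁺` are multiples of
a third one by Bézout's identity, and `m a = n a` with `m ≠ n` forces `a = 0 = 0 • 0`.
-/

/-! ### Epimorphic families and filtering functors -/

section Filtering

theorem isEpimorphicFamily_of_jointly_surjective {ι : Sort*} {A : ι → Type v} {B : Type v}
    (f : ∀ i, A i ⟶ B) (hf : ∀ b, ∃ i a, f i a = b) : IsEpimorphicFamily f := by
  intro Z g h hgh
  ext b
  obtain ⟨i, a, rfl⟩ := hf b
  exact ConcreteCategory.congr_hom (hgh i) a

theorem types_prod_ext {A B : Type v} {x y : (A ⨯ B : Type v)}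
    (hfst : (prod.fst : A ⨯ B ⟶ A) x = (prod.fst : A ⨯ B ⟶ A) y)
    (hsnd : (prod.snd : A ⨯ B ⟶ B) x = (prod.snd : A ⨯ B ⟶ B) y) : x = y := by
  refine Concrete.isLimit_ext _ (prodIsProd A B) _ _ ?_
  rintro ⟨_ | _⟩
  exacts [hfst, hsnd]

theorem isFiltering_of_isCofiltered_elements {C : Type u₁} [Category.{v} C] (A : C ⥤ Type v)
    [IsCofiltered A.Elements] : IsFiltering A where
  nonempty := isEpimorphicFamily_of_jointly_surjective _ fun b ↦ by
    obtain ⟨c, a⟩ := (IsCofiltered.nonempty : Nonempty A.Elements)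
    have : Subsingleton (⊤_ Type v) := Types.terminalIso.toEquiv.subsingleton
    exact ⟨c, a, Subsingleton.elim _ b⟩
  pair c d := isEpimorphicFamily_of_jointly_surjective _ fun b ↦ by
    obtain ⟨⟨e, a⟩, f, g, -⟩ := IsCofilteredOrEmpty.cone_objs
      (A.elementsMk c ((prod.fst : A.obj c ⨯ A.obj d ⟶ _) b))
      (A.elementsMk d ((prod.snd : A.obj c ⨯ A.obj d ⟶ _) b))
    refine ⟨⟨e, f.1, g.1⟩, a, types_prod_ext ?_ ?_⟩
    · rw [← comp_apply, prod.lift_fst]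
      exact f.2
    · rw [← comp_apply, prod.lift_snd]
      exact g.2
  parallel {c d} s t := isEpimorphicFamily_of_jointly_surjective _ fun b ↦ by
    let a₀ : A.obj c := equalizer.ι (A.map s) (A.map t) b
    have ha₀ : A.map s a₀ = A.map t a₀ :=
      ConcreteCategory.congr_hom (equalizer.condition (A.map s) (A.map t)) b
    obtain ⟨⟨e, a⟩, w, hw⟩ := IsCofilteredOrEmpty.cone_maps
      (CategoryOfElements.homMk (A.elementsMk c a₀) (A.elementsMk d (A.map s a₀)) s rfl)
      (CategoryOfElements.homMk (A.elementsMk c a₀) (A.elementsMk d (A.map s a₀)) t ha₀.symm)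
    refine ⟨⟨e, w.1, congrArg Subtype.val hw⟩, a,
      (mono_iff_injective (equalizer.ι (A.map s) (A.map t))).1 inferInstance ?_⟩
    rw [← comp_apply, equalizer.lift_ι]
    exact w.2

variable {ℰ : Type u₁} [Category.{v} ℰ]

theorem IsEpimorphicFamily.of_comp_isIso {ι : Sort*} {A : ι → ℰ} {B B' : ℰ} {f : ∀ i, A i ⟶ B}
    (e : B ⟶ B') [IsIso e] (hf : IsEpimorphicFamily fun i ↦ f i ≫ e) : IsEpimorphicFamily f := by
  intro Z g h hgh
  rw [← cancel_epi (inv e)]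
  exact hf _ _ fun i ↦ by simpa using hgh i

variable {κ : Type*} {𝒟 : κ → Type u₂} [∀ k, Category.{v} (𝒟 k)] {L : ∀ k, ℰ ⥤ 𝒟 k}

theorem IsEpimorphicFamily.of_jointlyFaithful (hL : JointlyFaithful L) {ι : Sort*} {A : ι → ℰ}
    {B : ℰ} {f : ∀ i, A i ⟶ B} (hf : ∀ k, IsEpimorphicFamily fun i ↦ (L k).map (f i)) :
    IsEpimorphicFamily f := by
  intro Z g h hgh
  refine hL.map_injective fun k ↦ hf k _ _ fun i ↦ ?_
  rw [← Functor.map_comp, ← Functor.map_comp, hgh i]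

theorem map_lift_prodComparison {𝒟 : Type*} [Category* 𝒟] (L : ℰ ⥤ 𝒟) {W Y Z : ℰ}
    [HasBinaryProduct Y Z] [HasBinaryProduct (L.obj Y) (L.obj Z)] (f : W ⟶ Y) (g : W ⟶ Z) :
    L.map (prod.lift f g) ≫ prodComparison L Y Z = prod.lift (L.map f) (L.map g) := by
  apply prod.hom_ext
  · rw [Category.assoc, prodComparison_fst, ← L.map_comp, prod.lift_fst, prod.lift_fst]
  · rw [Category.assoc, prodComparison_snd, ← L.map_comp, prod.lift_snd, prod.lift_snd]

theorem IsFiltering.of_jointlyFaithful [HasFiniteLimits ℰ] [∀ k, HasFiniteLimits (𝒟 k)]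
    [∀ k, PreservesFiniteLimits (L k)] (hL : JointlyFaithful L) {C : Type u₃} [Category.{v} C]
    {A : C ⥤ ℰ} (hA : ∀ k, IsFiltering (A ⋙ L k)) : IsFiltering A where
  nonempty := .of_jointlyFaithful hL fun k ↦ .of_comp_isIso (terminalComparison (L k)) <| by
    have hterminal (c : C) : (L k).map (terminal.from (A.obj c)) ≫ terminalComparison (L k) =
        terminal.from ((A ⋙ L k).obj c) := terminal.hom_ext _ _
    simp only [hterminal]
    exact (hA k).nonempty
  pair c d := .of_jointlyFaithful hL fun k ↦ .of_comp_isIso (prodComparison (L k) _ _) <| by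
    simp only [map_lift_prodComparison]
    exact (hA k).pair c d
  parallel s t := .of_jointlyFaithful hL fun k ↦
    .of_comp_isIso (equalizerComparison (A.map s) (A.map t) (L k)) <| by
      simp only [map_lift_equalizerComparison]
      exact (hA k).parallel s t

end Filtering

/-! ### Tensor products and flat functors -/

section Tensor

variable {C : Type v} [SmallCategory C] {ℰ : Type u₂} [Category.{v} ℰ] [HasColimits ℰ]
  {ℱ : Type u₃} [Category.{v} ℱ] [HasColimits ℱ]

/-- The restriction of `P ↦ P ⊗_C A` to representable presheaves is `A`. -/
noncomputable def uliftYonedaCompTensorFunctor (A : C ⥤ ℰ) :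
    uliftYoneda.{v} ⋙ tensorFunctor A ≅ A :=
  Presheaf.isExtensionAlongULiftYoneda.{v} A

/-- A colimit-preserving functor commutes with tensor products: `L (P ⊗_C A) ≅ P ⊗_C (L ∘ A)`. -/
noncomputable def tensorFunctorCompIso (A : C ⥤ ℰ) (L : ℰ ⥤ ℱ)
    [PreservesColimitsOfSize.{v, v} L] : tensorFunctor A ⋙ L ≅ tensorFunctor (A ⋙ L) :=
  have : PreservesColimitsOfSize.{v, v} (tensorFunctor A) :=
    Presheaf.preservesColimitsOfSize_leftKanExtension A
  Presheaf.uniqueExtensionAlongULiftYoneda (tensorFunctor A ⋙ L)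
    (Functor.isoWhiskerRight (uliftYonedaCompTensorFunctor A).symm L ≪≫ Functor.associator _ _ _)

/-- Tensor products with isomorphic functors are isomorphic. -/
noncomputable def tensorFunctorMapIso {A B : C ⥤ ℰ} (e : A ≅ B) :
    tensorFunctor A ≅ tensorFunctor B :=
  (uliftYoneda.{v}.lan).mapIso e

theorem GeomMorphism.nonempty_iso_iff_isomorphic_ofFlat (f : GeomMorphism ℰ (Cᵒᵖ ⥤ Type v))
    {A : C ⥤ ℰ} (hA : IsFlat A) :
    Nonempty (uliftYoneda.{v} ⋙ f.inverseImage ≅ A) ↔ f.Isomorphic (.ofFlat A hA) := by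
  have : PreservesColimitsOfSize.{v, v} f.inverseImage := f.adj.leftAdjoint_preservesColimits
  exact ⟨fun ⟨e⟩ ↦ ⟨Presheaf.uniqueExtensionAlongULiftYoneda f.inverseImage e.symm⟩,
    fun ⟨e⟩ ↦ ⟨Functor.isoWhiskerLeft _ e ≪≫ uliftYonedaCompTensorFunctor A⟩⟩

theorem GeomMorphism.comp_ofFlat_isomorphic (f : GeomMorphism ℱ ℰ) {A : C ⥤ ℰ} (hA : IsFlat A)
    {B : C ⥤ ℱ} (hB : IsFlat B) (e : A ⋙ f.inverseImage ≅ B) :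
    (f.comp (.ofFlat A hA)).Isomorphic (.ofFlat B hB) :=
  have : PreservesColimitsOfSize.{v, v} f.inverseImage := f.adj.leftAdjoint_preservesColimits
  ⟨tensorFunctorCompIso A f.inverseImage ≪≫ tensorFunctorMapIso e⟩

theorem preservesFiniteLimits_of_jointlyReflectIsomorphisms {𝒞 : Type*} [Category* 𝒞]
    {𝒜 : Type*} [Category* 𝒜] [HasFiniteLimits 𝒜] {κ : Type*} {𝒟 : κ → Type*}
    [∀ k, Category* (𝒟 k)] {L : ∀ k, 𝒜 ⥤ 𝒟 k} (hL : JointlyReflectIsomorphisms L)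
    [∀ k, PreservesFiniteLimits (L k)] (F : 𝒞 ⥤ 𝒜) [∀ k, PreservesFiniteLimits (F ⋙ L k)] :
    PreservesFiniteLimits F where
  preservesFiniteLimits _ _ _ := ⟨⟨fun hc ↦
    ⟨hL.jointlyReflectsLimit fun k ↦ isLimitOfPreserves (F ⋙ L k) hc⟩⟩⟩

theorem IsFlat.of_jointlyReflectIsomorphisms [HasFiniteLimits ℰ] {κ : Type*} {𝒟 : κ → Type u₃}
    [∀ k, Category.{v} (𝒟 k)] [∀ k, HasColimits (𝒟 k)] {L : ∀ k, ℰ ⥤ 𝒟 k}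
    (hL : JointlyReflectIsomorphisms L) [∀ k, PreservesFiniteLimits (L k)]
    [∀ k, PreservesColimitsOfSize.{v, v} (L k)] {A : C ⥤ ℰ} (hA : ∀ k, IsFlat (A ⋙ L k)) :
    IsFlat A :=
  have (k : κ) : PreservesFiniteLimits (tensorFunctor A ⋙ L k) :=
    have : PreservesFiniteLimits (tensorFunctor (A ⋙ L k)) := hA k
    preservesFiniteLimits_of_natIso (tensorFunctorCompIso A (L k)).symm
  preservesFiniteLimits_of_jointlyReflectIsomorphisms hL _

/-- A set-valued functor with cofiltered category of elements as a point of the site given by the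
trivial topology; its fibre functor on presheaves is then known to preserve finite limits. -/
noncomputable def pointOfCofilteredElements (A : C ⥤ Type v) [IsCofiltered A.Elements] :
    GrothendieckTopology.Point.{v} (⊥ : GrothendieckTopology C) where
  fiber := A
  initiallySmall :=
    have : EssentiallySmall.{v} A.Elements := essentiallySmallSelf.{v, v, v} _
    initiallySmall_of_essentiallySmall _
  jointly_surjective {U} R hR x := by
    obtain rfl : R = ⊤ := by simpa using hR
    exact ⟨U, 𝟙 _, by simp, x, by simp⟩

theorem isFlat_of_isCofiltered_elements (A : C ⥤ Type v) [IsCofiltered A.Elements] :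
    IsFlat A :=
  let Φ := pointOfCofilteredElements A
  let e : A ≅ uliftYoneda.{v} ⋙ Φ.presheafFiber :=
    Φ.shrinkYonedaCompPresheafFiberIso.symm ≪≫
      Functor.isoWhiskerRight uliftYonedaIsoShrinkYoneda.symm Φ.presheafFiber
  preservesFiniteLimits_of_natIso
    (Presheaf.uniqueExtensionAlongULiftYoneda.{v} (A := A) Φ.presheafFiber e)

theorem isCofiltered_elements_of_iso {𝒞 : Type*} [Category* 𝒞] {A B : 𝒞 ⥤ Type v} (e : A ≅ B)
    [IsCofiltered A.Elements] : IsCofiltered B.Elements :=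
  IsCofiltered.of_equivalence
    (((CategoryOfElements.structuredArrowEquivalence A).trans
      (StructuredArrow.mapNatIso e)).trans
        (CategoryOfElements.structuredArrowEquivalence B).symm)

end Tensor

/-! ### The stalk functors of a space -/

section Stalks

variable {X : TopCat.{0}}

instance stalkAt.preservesFiniteLimits (x : X) : PreservesFiniteLimits (stalkAt x) :=
  stalkAt_preservesFiniteLimits x

instance stalkAt.preservesColimits (x : X) : PreservesColimitsOfSize.{0, 0} (stalkAt x) :=
  (pointOfSpace x).adj.leftAdjoint_preservesColimits

variable (X) in
theorem jointlyReflectIsomorphisms_stalkAt :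
    JointlyReflectIsomorphisms fun x : X ↦ stalkAt x where
  isIso f hf :=
    have : ∀ x : X, IsIso ((TopCat.Presheaf.stalkFunctor Type x).map f.1) := hf
    TopCat.Presheaf.isIso_of_stalkFunctor_map_iso f

end Stalks

/-! ### Non-negative parts of subgroups of `ℚ` -/

theorem gcd_nsmul_mem {G : Type*} [AddGroup G] {H : AddSubgroup G} {d : G} {s t : ℕ}
    (hs : s • d ∈ H) (ht : t • d ∈ H) : s.gcd t • d ∈ H := by
  have bezout : s.gcd t • d = s.gcdA t • s • d + s.gcdB t • t • d := by
    rw [← natCast_zsmul d (s.gcd t), Nat.gcd_eq_gcd_ab, add_zsmul, mul_zsmul', mul_zsmul',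
      natCast_zsmul, natCast_zsmul]
  rw [bezout]
  exact H.add_mem (H.zsmul_mem hs _) (H.zsmul_mem ht _)

theorem exists_nonneg_common_submultiple {a b : ℚ} (ha : 0 ≤ a) (hb : 0 ≤ b) :
    ∃ d : ℚ, 0 ≤ d ∧ ∃ s t : ℕ, s • d = a ∧ t • d = b := by
  lift a to ℚ≥0 using ha
  lift b to ℚ≥0 using hb
  refine ⟨((a.den * b.den : ℚ≥0)⁻¹ : ℚ≥0), NNRat.cast_nonneg _,
    a.num * b.den, b.num * a.den, ?_, ?_⟩
  all_goals
    rw [nsmul_eq_mul]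
    norm_cast
    have := a.den_ne_zero
    have := b.den_ne_zero
  · conv_rhs => rw [← a.num_div_den]
    push_cast
    field_simp
  · conv_rhs => rw [← b.num_div_den]
    push_cast
    field_simp

theorem nonnegPart.exists_common_submultiple {H : AddSubgroup ℚ} (a b : nonnegPart H) :
    ∃ (c : nonnegPart H) (m n : ℕ), m • c = a ∧ n • c = b := by
  obtain ⟨a, ha, ha₀⟩ := a
  obtain ⟨b, hb, hb₀⟩ := b
  obtain ⟨d, hd, s, t, rfl, rfl⟩ := exists_nonneg_common_submultiple ha₀ hb₀
  obtain ⟨m, hm⟩ := s.gcd_dvd_left t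
  obtain ⟨n, hn⟩ := s.gcd_dvd_right t
  refine ⟨⟨s.gcd t • d, gcd_nsmul_mem ha hb, nsmul_nonneg hd _⟩, m, n,
    Subtype.ext ?_, Subtype.ext ?_⟩
  · exact (mul_nsmul d _ m).symm.trans (congrArg (· • d) hm.symm)
  · exact (mul_nsmul d _ n).symm.trans (congrArg (· • d) hn.symm)

instance isCofiltered_elements_nonnegFunctor (H : AddSubgroup ℚ) :
    IsCofiltered (nonnegFunctor H).Elements where
  nonempty := ⟨⟨NZeroTimes.pt, (0 : nonnegPart H)⟩⟩
  cone_objs := by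
    rintro ⟨_, a⟩ ⟨_, b⟩
    obtain ⟨c, m, n, hm, hn⟩ := nonnegPart.exists_common_submultiple (H := H) a b
    exact ⟨⟨NZeroTimes.pt, c⟩, ⟨m, hm⟩, ⟨n, hn⟩, trivial⟩
  cone_maps := by
    rintro ⟨_, (a : nonnegPart H)⟩ ⟨_, b⟩ ⟨(m : ℕ), (hm : m • a = b)⟩ ⟨(n : ℕ), (hn : n • a = b)⟩
    by_cases hmn : m = n
    · subst hmn
      exact ⟨_, 𝟙 _, rfl⟩
    · obtain rfl : a = 0 := by
        by_contra ha
        exact hmn (IsAddLeftRegular.nsmul_injective (.all a) ha (hm.trans hn.symm))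
      exact ⟨⟨NZeroTimes.pt, (0 : nonnegPart H)⟩, ⟨(0 : ℕ), zero_nsmul (0 : nonnegPart H)⟩,
        Subtype.ext ((Nat.mul_zero m).trans (Nat.mul_zero n).symm)⟩

theorem isFlat_nonnegFunctor (H : AddSubgroup ℚ) : IsFlat (nonnegFunctor H) :=
  isFlat_of_isCofiltered_elements _

/-! ### The stalks of the sheaf `𝒮` -/

theorem isClosed_of_finite_of_bot_notMem {R : Type*} [CommRing R] [IsDomain R]
    [Ring.DimensionLEOne R] {s : Set (PrimeSpectrum R)} (hs : s.Finite) (hbot : ⊥ ∉ s) :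
    IsClosed s := by
  rw [← Set.biUnion_of_singleton s]
  refine hs.isClosed_biUnion fun x hx ↦ (PrimeSpectrum.isClosed_singleton_iff_isMaximal x).2 ?_
  exact Ring.DimensionLEOne.maximalOfPrime
    (fun h ↦ hbot ((PrimeSpectrum.ext h : x = ⊥) ▸ hx)) x.2

theorem nonnegPart_pointGroup_generic_eq_zero (q : nonnegPart (pointGroup genericPointZ)) :
    q = 0 :=
  Subtype.ext (AddSubgroup.mem_bot.1 (pointGroup_generic.le q.2.1))

theorem exists_openNhds_forall_ne_eq_zero {x : SpecZ} (U : OpenNhds x)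
    {ξ : ∀ y : U.1, nonnegPart (pointGroup y)} (hξ : finitelySupported.pred ξ) :
    ∃ (W : OpenNhds x) (i : W ⟶ U), ∀ y : W.1, (y : SpecZ) ≠ x → ξ (i y : U.1) = 0 := by
  let s : Set SpecZ := (fun y : U.1 ↦ (y : SpecZ)) '' {y : U.1 | ξ y ≠ 0 ∧ (y : SpecZ) ≠ x}
  have hs : IsClosed s := by
    refine isClosed_of_finite_of_bot_notMem ((hξ.subset fun y hy ↦ hy.1).image _) ?_
    rintro ⟨⟨_, _⟩, ⟨h, -⟩, rfl⟩
    exact h (nonnegPart_pointGroup_generic_eq_zero _)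
  have hxs : x ∉ s := by
    rintro ⟨y, ⟨-, hy⟩, hyx⟩
    exact hy hyx
  refine ⟨⟨U.1 ⊓ ⟨sᶜ, hs.isOpen_compl⟩, U.2, hxs⟩, homOfLE (inf_le_left (a := U.1)), fun y hy ↦ ?_⟩
  by_contra h
  exact y.2.2 ⟨⟨y, y.2.1⟩, ⟨h, hy⟩, rfl⟩

theorem stalkToFiber_finitelySupported_injective (x : SpecZ) :
    Function.Injective (TopCat.stalkToFiber finitelySupported x) := by
  refine TopCat.stalkToFiber_injective _ x fun U V ξ hξ ζ hζ h ↦ ?_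
  obtain ⟨W₁, i₁, h₁⟩ := exists_openNhds_forall_ne_eq_zero U hξ
  obtain ⟨W₂, i₂, h₂⟩ := exists_openNhds_forall_ne_eq_zero V hζ
  refine ⟨W₁ ⊓ W₂, homOfLE inf_le_left ≫ i₁, homOfLE inf_le_right ≫ i₂, ?_⟩
  rintro ⟨y, hy₁, hy₂⟩
  by_cases hy : y = x
  · subst hy
    exact h
  · exact (h₁ ⟨y, hy₁⟩ hy).trans (h₂ ⟨y, hy₂⟩ hy).symm

theorem stalkToFiber_finitelySupported_surjective (x : SpecZ) :
    Function.Surjective (TopCat.stalkToFiber finitelySupported x) := by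
  classical
  refine TopCat.stalkToFiber_surjective _ x fun q ↦ ?_
  let ξ : ∀ y : SpecZ, nonnegPart (pointGroup y) := Pi.single x q
  refine ⟨⟨⊤, trivial⟩, fun y ↦ ξ y, ?_,
    Pi.single_eq_same (M := fun y ↦ nonnegPart (pointGroup y)) x q⟩
  refine (Set.finite_singleton (⟨x, trivial⟩ : (⊤ : Opens SpecZ))).subset fun y hy ↦ ?_
  by_contra h
  have hyx : (y : SpecZ) ≠ x := fun h' ↦ h (Subtype.ext h')
  exact hy (Pi.single_eq_of_ne (M := fun y ↦ nonnegPart (pointGroup y)) hyx q)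

theorem stalkToFiber_stalkAt_map_mulS (x : SpecZ) (n : ℕ) (s : (stalkAt x).obj sheafS) :
    TopCat.stalkToFiber finitelySupported x ((stalkAt x).map (mulS n) s) =
      n • TopCat.stalkToFiber finitelySupported x s := by
  obtain ⟨U, hx, ξ, rfl⟩ := TopCat.Presheaf.exists_germ_eq sheafS.presheaf s
  calc TopCat.stalkToFiber finitelySupported x
        ((stalkAt x).map (mulS n) (sheafS.presheaf.germ U x hx ξ))
    _ = TopCat.stalkToFiber finitelySupported x
          (sheafS.presheaf.germ U x hx ((mulS n).1.app (op U) ξ)) :=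
        congrArg _ (TopCat.Presheaf.stalkFunctor_map_germ_apply U x hx (mulS n).1 ξ)
    _ = n • ξ.1 ⟨x, hx⟩ := TopCat.stalkToFiber_germ finitelySupported U x hx _
    _ = n • TopCat.stalkToFiber finitelySupported x (sheafS.presheaf.germ U x hx ξ) :=
        congrArg (n • ·) (TopCat.stalkToFiber_germ finitelySupported U x hx ξ).symm

/-- The stalk of `𝒮` at `x`, with its action of the non-negative integers, is `H(x)⁺`. -/
noncomputable def functorSCompStalkAtIso (x : SpecZ) :
    functorS ⋙ stalkAt x ≅ nonnegFunctor (pointGroup x) :=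
  NatIso.ofComponents
    (fun _ ↦ (Equiv.ofBijective _ ⟨stalkToFiber_finitelySupported_injective x,
      stalkToFiber_finitelySupported_surjective x⟩).toIso)
    (fun n ↦ by
      ext s
      exact stalkToFiber_stalkAt_map_mulS x n s)

instance isCofiltered_elements_functorS_comp_stalkAt (x : SpecZ) :
    IsCofiltered (functorS ⋙ stalkAt x).Elements :=
  isCofiltered_elements_of_iso (functorSCompStalkAtIso x).symm

theorem isFiltering_functorS : IsFiltering functorS :=
  .of_jointlyFaithful (jointlyReflectIsomorphisms_stalkAt SpecZ).jointlyFaithful fun _ ↦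
    isFiltering_of_isCofiltered_elements _

theorem isFlat_functorS : IsFlat functorS :=
  .of_jointlyReflectIsomorphisms (jointlyReflectIsomorphisms_stalkAt SpecZ) fun _ ↦
    isFlat_of_isCofiltered_elements _

theorem pointOfSpace_comp_ofFlat_functorS_isomorphic {x : SpecZ} {H : AddSubgroup ℚ}
    (hx : pointGroup x = H) :
    ((pointOfSpace x).comp (.ofFlat functorS isFlat_functorS)).Isomorphic
      (.ofFlat (nonnegFunctor H) (isFlat_nonnegFunctor H)) := by
  subst hx
  exact GeomMorphism.comp_ofFlat_isomorphic _ _ _ (functorSCompStalkAtIso x)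

theorem theorem4p3 :
    -- the stalk of the sheaf at every point `x` is the non-negative part of the group attached
    -- to `x`, via the value of sections at `x`, compatibly with the action
    (∀ x : SpecZ, ∃ e : functorS ⋙ stalkAt x ≅ nonnegFunctor (pointGroup x),
      e.hom.app NZeroTimes.pt = TopCat.stalkToFiber finitelySupported x) ∧
    -- the functor given by the sheaf and its action is filtering
    IsFiltering functorS ∧
    -- it is flat, and hence defines a geometric morphism `Θ`
    ∃ hS : IsFlat functorS,
      -- `Θ` is, up to isomorphism, the unique geometric morphism whose inverse image restricts to
      -- the functor along the Yoneda embedding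
      (∀ f : GeomMorphism (TopCat.Sheaf Type SpecZ) (NZeroTimesᵒᵖ ⥤ Type),
        Nonempty (uliftYoneda.{0} ⋙ f.inverseImage ≅ functorS) ↔
          f.Isomorphic (GeomMorphism.ofFlat functorS hS)) ∧
      -- the image of `p` is the point associated with `H(p)`
      (∀ p : Nat.Primes, ∃ hp : IsFlat (nonnegFunctor (fractionGroup p)),
        ((pointOfSpace (primePoint p)).comp (GeomMorphism.ofFlat functorS hS)).Isomorphic
          (GeomMorphism.ofFlat (nonnegFunctor (fractionGroup p)) hp)) ∧
      -- the image of the generic point is the base point, associated with the trivial subgroup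
      ∃ h0 : IsFlat (nonnegFunctor ⊥),
        ((pointOfSpace genericPointZ).comp (GeomMorphism.ofFlat functorS hS)).Isomorphic
          (GeomMorphism.ofFlat (nonnegFunctor ⊥) h0) := by
  exact ⟨fun x ↦ ⟨functorSCompStalkAtIso x, rfl⟩, isFiltering_functorS, isFlat_functorS,
    fun f ↦ f.nonempty_iso_iff_isomorphic_ofFlat isFlat_functorS,
    fun p ↦ ⟨isFlat_nonnegFunctor _,
      pointOfSpace_comp_ofFlat_functorS_isomorphic (pointGroup_prime p)⟩,
    isFlat_nonnegFunctor _, pointOfSpace_comp_ofFlat_functorS_isomorphic pointGroup_generic⟩
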